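/- **Setting.** Let $T=a_1\dots a_n$ be a text over a finite alphabet, read online; at time $i\le n$ the prefix $T_i=a_1\dots a_i$ has been read. An occurrence of a word $w$ in $T_i$ starting at position $j\in\{1,\dots,i\}$ has offset $i-j$; if $w$ occurs in $T_i$, $\mathrm{rightmost}_i(w)$ is the smallest offset of an occurrence. Let $\mathrm{Bitlen}:\mathbb N\to\mathbb N$ be the codeword length of a code for numbers. The query $\mathrm{REP}(w)$ at time $i$ asks for a position $j$ of an occurrence of $w$ in $T_i$ with $\mathrm{Bitlen}(i-j)=\mathrm{Bitlen}(\mathrm{rightmost}_i(w))$, and for the answer $0$ if $w$ does not occur in $T_i$. Let $B_i=\mathrm{Bitlen}(\{0,\dots,i\})$ and $SW_i=\{\max\{j\le i:\mathrm{Bitlen}(j)\le b\}:b\in B_i\}=\{sw_1<\dots<sw_s\}$. The *multilayer suffix tree* at time $i$ consists of one suffix tree (without end marker) for each $\alpha\in SW_i$, the layer $\alpha$, for the window $T[i-\alpha:i]$ formed by the positions of $T_i$ with offset at most $\alpha$; a pattern is in layer $\alpha$ if it is a factor of this window. In memory there are the text $T_i$, an array of the roots of the layers in increasing order of size together with the number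 of layers, and for every node of every layer a record with its string depth, a position in the text of the label of its incoming edge (coming from an occurrence in the window of the word spelled by the node), and a table of child pointers indexed by letters. A *classic variable-length code* is one for which $\mathrm{Bitlen}$ is non-decreasing and at least one of the following holds: there are $k>1$ and $\hat k$ such that for every text length $sw_m\ge k\,sw_{m-1}$ for all $m$ with $\max(2,\hat k)\le m<s$; or $\mathrm{Bitlen}(x)=O(\log x)$. **Proposition.** The multilayer suffix tree exists in memory for every code, text and time $i$, together with any pattern. There is a query program for a unit-cost random access machine (with addition, subtraction, halving, comparison and indirect addressing) such that for every classic variable-length code there is a constant $C$, depending only on the code, with the following properties. For every $i$, the number of layers satisfies $|SW_i|\le C\max(1,\log i)$. For every finite alphabet, every text $T$ over it, every time $i\le|T|$ and every non-empty pattern $p$ over it, started on any memory image of the multilayer suffix tree at time $i$ and of $p$, the program halts after at most $C\,|p|\,\max(1,\log\log i)$ steps (so in $O(|p|\log\log i)$ time), leaves the memory unchanged, and returns a correct answer to $\mathrm{REP}(p)$ at time $i$; if $p$ occurs in $T_i$, the returned occurrence lies in the smallest layer containing $p$. (Here $\log 0$ is read as $0$ and $\log x$ as $\log|x|$.) -/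

import Mathlib

namespace MLST

/-! ## Occurrences, offsets and rightmost equal-cost positions -/

section Words

variable {A : Type}

/-- The starting positions (numbered from `0`) of the occurrences of `w` in the text `T`. -/
def Pos (T w : List A) : Set ℕ := {y | y < T.length ∧ w <+: T.drop y}

/-- The offset, with respect to the end of the text `T`, of the position `y < |T|`. -/
def offset (T : List A) (y : ℕ) : ℕ := T.length - y - 1

/-- The set of the offsets of the occurrences of `w` in the text `T`. -/
def Offset (T w : List A) : Set ℕ := offset T '' Pos T w

/-- `x` is the offset of the rightmost occurrence of `w` in `T` (if there is an occurrence). -/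
def IsRightmost (T w : List A) (x : ℕ) : Prop := IsLeast (Offset T w) x

/-- `r` is a correct answer to the query `REP(w)` over the text `T`: if `w` does not occur in `T`
the answer is `0`; otherwise it is the position, numbered from `1` (so that `0` is unambiguous),
of an occurrence of `w` whose offset has the same codeword length as the rightmost offset. -/
def IsREP (bitlen : ℕ → ℕ) (T w : List A) (r : ℕ) : Prop :=
  (Pos T w = ∅ ∧ r = 0) ∨
    ∃ y ∈ Pos T w, r = y + 1 ∧ ∃ x, IsRightmost T w x ∧ bitlen (offset T y) = bitlen x

end Words

/-! ## The layer sizes determined by a number code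

The code enters through the function `bitlen`, the codeword length of a number. Offsets start
at `0` (last position of the text), so the offsets considered over a text of length `n` are
`0, …, n`. For a code of the positive integers only, `bitlen 0 = bitlen 1` gives the usual sets. -/

/-- The set of the codeword lengths of all the possible offsets over a text of length `n`. -/
def B (bitlen : ℕ → ℕ) (n : ℕ) : Finset ℕ := (Finset.range (n + 1)).image bitlen

/-- The greatest `j ≤ n` with `bitlen j ≤ b`. -/
def swOf (bitlen : ℕ → ℕ) (n b : ℕ) : ℕ :=
  ((Finset.range (n + 1)).filter (fun j => bitlen j ≤ b)).sup id

/-- The set of the layer sizes for a text of length `n`. -/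
def SW (bitlen : ℕ → ℕ) (n : ℕ) : Finset ℕ := (B bitlen n).image (swOf bitlen n)

/-- The layer sizes in increasing order. -/
def swList (bitlen : ℕ → ℕ) (n : ℕ) : List ℕ := (SW bitlen n).sort (· ≤ ·)

/-- The `m`-th smallest layer size, for `1 ≤ m ≤ |SW|`. -/
def sw (bitlen : ℕ → ℕ) (n m : ℕ) : ℕ := (swList bitlen n).getD (m - 1) 0

/-- From some index on, all layer sizes except the last one (which is cut off at the text length)
grow by a constant factor greater than `1`. -/
def ExponentialGrowth (bitlen : ℕ → ℕ) : Prop :=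
  ∃ k : ℝ, 1 < k ∧ ∃ k' : ℕ, ∀ n m : ℕ, k' ≤ m → 2 ≤ m → m < (SW bitlen n).card →
    k * (sw bitlen n (m - 1) : ℝ) ≤ (sw bitlen n m : ℝ)

/-- Classic variable-length codes: the codeword length is monotone, and either its equal-cost
classes grow exponentially, or it is at most proportional to the logarithm of the number. -/
def IsClassicCode (bitlen : ℕ → ℕ) : Prop :=
  Monotone bitlen ∧
    (ExponentialGrowth bitlen ∨
      (fun x : ℕ => (bitlen x : ℝ)) =O[Filter.atTop] (fun x : ℕ => Real.log (x : ℝ)))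

/-! ## Suffix trees and layers -/

section SuffixTree

variable {A : Type}

/-- The explicit nodes of the suffix tree of `w` (without end marker), identified with the words
spelled from the root: the root, the factors of `w` with two different right extensions, and the
leaves, which are the non-empty suffixes without a right extension. -/
def IsNode (w v : List A) : Prop :=
  v = [] ∨
    (∃ a b : A, a ≠ b ∧ v ++ [a] <:+: w ∧ v ++ [b] <:+: w) ∨
      (v ≠ [] ∧ v <:+ w ∧ ∀ a : A, ¬ (v ++ [a] <:+: w))

/-- There is an edge of the suffix tree of `w` from `u` to `v` whose label starts with `a`. -/
def IsEdge (w u : List A) (a : A) (v : List A) : Prop :=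
  IsNode w u ∧ IsNode w v ∧ u ++ [a] <+: v ∧
    ∀ z, IsNode w z → u ++ [a] <+: z → z <+: v → z = v

/-- The first position (from `0`) of the window of `T` for the layer of size `α`: this window
holds exactly the positions whose offset is at most `α`. -/
def windowStart (T : List A) (α : ℕ) : ℕ := T.length - (α + 1)

/-- The window of `T` for the layer of size `α`. -/
def window (T : List A) (α : ℕ) : List A := T.drop (windowStart T α)

/-- The pattern `p` is in the layer of size `α`. -/
def InLayer (T : List A) (α : ℕ) (p : List A) : Prop := p <:+: window T α

end SuffixTree

/-! ## Random access machines with unit cost -/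

/-- Registers and memory of a random access machine. -/
structure State where
  reg : ℕ → ℕ
  mem : ℕ → ℕ

/-- `reg x := n`. -/
def State.setReg (s : State) (x n : ℕ) : State := { s with reg := Function.update s.reg x n }

/-- `mem a := n`. -/
def State.setMem (s : State) (a n : ℕ) : State := { s with mem := Function.update s.mem a n }

/-- Programs of the random access machine; `x`, `y`, `z` are names of registers. -/
inductive Program where
  /-- `x := n` -/
  | const (x n : ℕ)
  /-- `x := y` -/
  | copy (x y : ℕ)
  /-- `x := y + z` -/
  | add (x y z : ℕ)
  /-- `x := y - z` (truncated) -/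
  | sub (x y z : ℕ)
  /-- `x := ⌊y / 2⌋` -/
  | half (x y : ℕ)
  /-- `x := mem[y]` -/
  | load (x y : ℕ)
  /-- `mem[x] := y` -/
  | store (x y : ℕ)
  | seq (c d : Program)
  /-- if `x < y` then `c` else `d` -/
  | ifLt (x y : ℕ) (c d : Program)
  /-- while `x < y` do `c` -/
  | whileLt (x y : ℕ) (c : Program)

/-- `Run c s s' t`: started in `s`, the program `c` halts in `s'` after exactly `t` steps, where
each elementary instruction and each evaluation of a test is one step. -/
inductive Run : Program → State → State → ℕ → Prop where
  | const (s : State) (x n : ℕ) : Run (.const x n) s (s.setReg x n) 1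
  | copy (s : State) (x y : ℕ) : Run (.copy x y) s (s.setReg x (s.reg y)) 1
  | add (s : State) (x y z : ℕ) : Run (.add x y z) s (s.setReg x (s.reg y + s.reg z)) 1
  | sub (s : State) (x y z : ℕ) : Run (.sub x y z) s (s.setReg x (s.reg y - s.reg z)) 1
  | half (s : State) (x y : ℕ) : Run (.half x y) s (s.setReg x (s.reg y / 2)) 1
  | load (s : State) (x y : ℕ) : Run (.load x y) s (s.setReg x (s.mem (s.reg y))) 1
  | store (s : State) (x y : ℕ) : Run (.store x y) s (s.setMem (s.reg x) (s.reg y)) 1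
  | seq {c d : Program} {s s₁ s₂ : State} {t₁ t₂ : ℕ}
      (h₁ : Run c s s₁ t₁) (h₂ : Run d s₁ s₂ t₂) : Run (.seq c d) s s₂ (t₁ + t₂)
  | ifTrue {x y : ℕ} {c d : Program} {s s₁ : State} {t : ℕ}
      (h : s.reg x < s.reg y) (h₁ : Run c s s₁ t) : Run (.ifLt x y c d) s s₁ (t + 1)
  | ifFalse {x y : ℕ} {c d : Program} {s s₁ : State} {t : ℕ}
      (h : ¬ s.reg x < s.reg y) (h₁ : Run d s s₁ t) : Run (.ifLt x y c d) s s₁ (t + 1)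
  | whileFalse {x y : ℕ} {c : Program} {s : State}
      (h : ¬ s.reg x < s.reg y) : Run (.whileLt x y c) s s 1
  | whileTrue {x y : ℕ} {c : Program} {s s₁ s₂ : State} {t₁ t₂ : ℕ}
      (h : s.reg x < s.reg y) (h₁ : Run c s s₁ t₁) (h₂ : Run (.whileLt x y c) s₁ s₂ t₂) :
      Run (.whileLt x y c) s s₂ (t₁ + t₂ + 1)

/-! ## The data structure in memory

The alphabet is `{0, …, σ - 1}`. -/

/-- The word `w` is stored from address `a` on, one letter per cell. -/
def StoresWord {σ : ℕ} (mem : ℕ → ℕ) (a : ℕ) (w : List (Fin σ)) : Prop :=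
  ∀ (j : ℕ) (h : j < w.length), mem (a + j) = (w[j] : ℕ)

/-- The suffix tree of the window of `T` of size `α`, with root at address `root`, is stored in
`mem`. The address of the record of the node `v` is `addr v`. The record holds in cell `0` the
string depth of `v`, in cell `1` the position in the text `T` (from `0`) of the label of the
incoming edge, taken from an occurrence of `v` inside the window (nothing is required for the
root), and in cell `2 + a` the address of the child for the letter `a`, or `0` if there is none.
Other cells are unconstrained: they may hold further data such as suffix links. -/
def StoresSuffixTree {σ : ℕ} (mem : ℕ → ℕ) (T : List (Fin σ)) (α root : ℕ) : Prop :=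
  ∃ addr : List (Fin σ) → ℕ,
    addr [] = root ∧
    Set.InjOn addr {v | IsNode (window T α) v} ∧
    (∀ v, IsNode (window T α) v → addr v ≠ 0 ∧ mem (addr v) = v.length) ∧
    (∀ u a v, IsEdge (window T α) u a v →
      mem (addr u + 2 + (a : ℕ)) = addr v ∧
      ∃ y, windowStart T α ≤ y ∧ v <+: T.drop y ∧ mem (addr v + 1) = y + u.length) ∧
    (∀ u a, IsNode (window T α) u → (¬ ∃ v, IsEdge (window T α) u a v) →
      mem (addr u + 2 + (a : ℕ)) = 0)

/-- The multilayer suffix tree of the text `T` is stored in `s`: register `0` holds the address of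
`T`, register `1` the address of an array with the addresses of the roots of the layers, in
increasing order of layer size, and register `2` the number of layers. -/
def StoresMLST {σ : ℕ} (bitlen : ℕ → ℕ) (T : List (Fin σ)) (s : State) : Prop :=
  StoresWord s.mem (s.reg 0) T ∧
  s.reg 2 = (swList bitlen T.length).length ∧
  ∀ (m : ℕ) (h : m < (swList bitlen T.length).length),
    StoresSuffixTree s.mem T (swList bitlen T.length)[m] (s.mem (s.reg 1 + m))

/-- Register `3` holds the address of the pattern `p` and register `4` its length. -/
def StoresPattern {σ : ℕ} (p : List (Fin σ)) (s : State) : Prop :=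
  StoresWord s.mem (s.reg 3) p ∧ s.reg 4 = p.length

end MLST

namespace MLST

/-! ### Suffix trees, windows and the descent of a pattern -/

section Combinatorics

variable {A : Type}

/-! Windows grow with the layer size, so containing the pattern is a monotone property of layers
(`InLayer.mono`), and the smallest layer containing it is found by binary search. Each test descends
one suffix tree letter by letter, reading edge letters from the text, at a bounded cost per letter.
A mismatch or a missing child refutes membership, because a factor that enters an edge must follow
it (`IsEdge.prefix_or_prefix`) and every factor `u ++ [a]` with `u` a node has an edge
(`exists_isEdge`). After a full match, the occurrence recorded for the current node is one of the
pattern.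

An occurrence in the smallest layer is a correct answer (`isREP_of_minimal`): if `x` is the
rightmost offset, the layer `swOf bitlen n (bitlen x)` contains the pattern, so the occurrence found
has offset at most that size, hence codeword length at most `bitlen x`; monotonicity gives the
converse.

With `s` layers this costs `O(|p| log s)`, and `s = O(log i)`: either there are only logarithmically
many codeword lengths, or the layer sizes grow geometrically up to `i`. A memory image exists
because the node records can be put into disjoint blocks numbered by an encoding of pairs of layer
index and word. -/

theorem IsNode.isInfix {w v : List A} (h : IsNode w v) : v <:+: w := by
  rcases h with rfl | ⟨a, b, -, ha, -⟩ | ⟨-, h, -⟩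
  · exact List.nil_infix
  · exact (List.prefix_append v [a]).isInfix.trans ha
  · exact h.isInfix

/-- Every non-empty factor can be prolonged to a node. -/
theorem exists_isNode_of_isInfix {w x : List A} (hx : x ≠ []) (h : x <:+: w) :
    ∃ z, IsNode w z ∧ x <+: z := by
  induction hn : w.length - x.length using Nat.strong_induction_on generalizing x with
  | _ n ih =>
    by_cases hext : ∃ a, x ++ [a] <:+: w
    · obtain ⟨a, ha⟩ := hext
      have hlen := ha.length_le
      simp only [List.length_append, List.length_singleton] at hlen
      obtain ⟨z, hz, hxz⟩ := ih (w.length - (x ++ [a]).length)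
        (by simp only [List.length_append, List.length_singleton]; omega) (by simp) ha rfl
      exact ⟨z, hz, (List.prefix_append x [a]).trans hxz⟩
    · refine ⟨x, Or.inr (Or.inr ⟨hx, ?_, fun a ha => hext ⟨a, ha⟩⟩), List.prefix_rfl⟩
      obtain ⟨s, t, rfl⟩ := h
      cases t with
      | nil => exact ⟨s, by simp⟩
      | cons c t => exact absurd ⟨c, s, t, by simp⟩ hext

/-- The child is a shortest node starting with `u ++ [a]`; minimal length gives the minimality
required of an edge. -/
theorem exists_isEdge {w u : List A} {a : A} (hu : IsNode w u) (h : u ++ [a] <:+: w) :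
    ∃ v, IsEdge w u a v := by
  classical
  have hex : ∃ n, ∃ z, IsNode w z ∧ u ++ [a] <+: z ∧ z.length = n := by
    obtain ⟨z, hz, hz'⟩ := exists_isNode_of_isInfix (by simp) h
    exact ⟨_, z, hz, hz', rfl⟩
  obtain ⟨v, hv, huv, hlen⟩ := Nat.find_spec hex
  refine ⟨v, hu, hv, huv, fun z hz huz hzv => hzv.eq_of_length_le ?_⟩
  rw [hlen]
  exact Nat.find_min' hex ⟨z, hz, huz, rfl⟩

theorem prefix_or_prefix_or_branch (x y : List A) :
    x <+: y ∨ y <+: x ∨ ∃ z a b, a ≠ b ∧ z ++ [a] <+: x ∧ z ++ [b] <+: y := by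
  induction x generalizing y with
  | nil => exact Or.inl List.nil_prefix
  | cons c x ih =>
    cases y with
    | nil => exact Or.inr (Or.inl List.nil_prefix)
    | cons d y =>
      by_cases hcd : c = d
      · subst hcd
        rcases ih y with h | h | ⟨z, a, b, hab, ha, hb⟩
        · exact Or.inl (by simpa using h)
        · exact Or.inr (Or.inl (by simpa using h))
        · exact Or.inr (Or.inr ⟨c :: z, a, b, hab, by simpa using ha, by simpa using hb⟩)
      · exact Or.inr (Or.inr ⟨[], c, d, hcd, by simp, by simp⟩)

/-- A factor that enters an edge does not leave it before its end. -/
theorem IsEdge.prefix_or_prefix {w u v q : List A} {a : A} (h : IsEdge w u a v)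
    (huq : u ++ [a] <+: q) (hq : q <:+: w) : q <+: v ∨ v <+: q := by
  obtain ⟨-, hv, huv, hmin⟩ := h
  rcases prefix_or_prefix_or_branch q v with h | h | ⟨z, b, c, hbc, hb, hc⟩
  · exact Or.inl h
  · exact Or.inr h
  · exfalso
    -- Since `q` and `v` share the prefix `u ++ [a]`, they can only branch at or after its end. The
    -- branching word `z` is then a node strictly inside the edge.
    have huz : u ++ [a] <+: z := by
      rcases Nat.lt_or_ge z.length (u ++ [a]).length with hlt | hge
      · have h1 := List.prefix_of_prefix_length_le hb huq (by simpa using hlt)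
        have h2 := List.prefix_of_prefix_length_le hc huv (by simpa using hlt)
        have h3 := List.prefix_of_prefix_length_le h1 h2 (by simp)
        have h4 := h3.eq_of_length (by simp)
        exact absurd (by simpa using h4) hbc
      · exact List.prefix_of_prefix_length_le huq ((List.prefix_append z [b]).trans hb) hge
    have hz : IsNode w z :=
      Or.inr (Or.inl ⟨b, c, hbc, hb.isInfix.trans hq, hc.isInfix.trans hv.isInfix⟩)
    have hzv := hmin z hz huz ((List.prefix_append z [c]).trans hc)
    subst hzv
    simpa using hc.length_le

theorem IsEdge.length_lt {w u v : List A} {a : A} (h : IsEdge w u a v) : u.length < v.length := by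
  simpa [Nat.succ_le_iff] using h.2.2.1.length_le

theorem IsEdge.child_unique {w u v v' : List A} {a : A} (h : IsEdge w u a v)
    (h' : IsEdge w u a v') : v = v' := by
  rcases h.prefix_or_prefix h'.2.2.1 h'.2.1.isInfix with hp | hp
  · exact (h.2.2.2 v' h'.2.1 h'.2.2.1 hp).symm
  · exact h'.2.2.2 v h.2.1 h.2.2.1 hp

/-- Two parents are both prefixes of `v`, and a longer one would be a node inside the edge of the
other. Uniqueness makes the label position, which involves the parent's depth, a property of the
node alone. -/
theorem IsEdge.parent_unique {w u u' v : List A} {a a' : A} (h : IsEdge w u a v)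
    (h' : IsEdge w u' a' v) : u = u' := by
  have key : ∀ {u u' : List A} {a a' : A}, IsEdge w u a v → IsEdge w u' a' v →
      u'.length ≤ u.length := by
    intro u u' a a' h h'
    by_contra! hlt
    have hu'v : u' <+: v := (List.prefix_append u' [a']).trans h'.2.2.1
    have h1 : u ++ [a] <+: u' := List.prefix_of_prefix_length_le h.2.2.1 hu'v (by simpa using hlt)
    have h2 := h.2.2.2 u' h'.1 h1 hu'v
    have h3 := h'.length_lt
    simp [h2] at h3
  have huv : u <+: v := (List.prefix_append u [a]).trans h.2.2.1
  have hu'v : u' <+: v := (List.prefix_append u' [a']).trans h'.2.2.1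
  exact (List.prefix_of_prefix_length_le huv hu'v (key h' h)).eq_of_length_le (key h h')

theorem windowStart_anti (T : List A) {α β : ℕ} (h : α ≤ β) :
    windowStart T β ≤ windowStart T α := by
  unfold windowStart; omega

theorem inLayer_iff {T p : List A} {α : ℕ} :
    InLayer T α p ↔ ∃ y, windowStart T α ≤ y ∧ p <+: T.drop y := by
  unfold InLayer window
  rw [List.infix_iff_prefix_suffix]
  constructor
  · rintro ⟨t, hpt, hts⟩
    obtain ⟨l, hl⟩ := hts
    refine ⟨windowStart T α + l.length, by omega, ?_⟩
    rw [← List.drop_drop, ← hl]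
    simpa using hpt
  · rintro ⟨y, hy, hpy⟩
    refine ⟨T.drop y, hpy, ?_⟩
    obtain ⟨k, rfl⟩ := Nat.exists_eq_add_of_le hy
    rw [← List.drop_drop]
    exact List.drop_suffix _ _

theorem InLayer.mono {T p : List A} {α β : ℕ} (hαβ : α ≤ β) (h : InLayer T α p) :
    InLayer T β p := by
  rw [inLayer_iff] at h ⊢
  obtain ⟨y, hy, hpy⟩ := h
  exact ⟨y, (windowStart_anti T hαβ).trans hy, hpy⟩

theorem lt_length_of_prefix_drop {T p : List A} {y : ℕ} (hp : p ≠ []) (h : p <+: T.drop y) :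
    y < T.length := by
  have h1 := h.length_le
  have h2 := List.length_pos_iff.mpr hp
  rw [List.length_drop] at h1
  omega

/-- `p.take j` has been matched down to the locus `v`, the node at or below which the descent
currently stands, and `y` is an occurrence of `v` in the window (unless `v` is the root). -/
structure AtLocus (T : List A) (α : ℕ) (p : List A) (j : ℕ) (v : List A) (y : ℕ) : Prop where
  isNode : IsNode (window T α) v
  take_prefix : p.take j <+: v
  edge : v = [] ∧ j = 0 ∨
    (∃ u a, IsEdge (window T α) u a v ∧ u.length < j) ∧ windowStart T α ≤ y ∧ v <+: T.drop y

namespace AtLocus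

variable {T p v : List A} {α j y : ℕ}

theorem root (T : List A) (α : ℕ) (p : List A) (y : ℕ) : AtLocus T α p 0 [] y :=
  ⟨Or.inl rfl, by simp, Or.inl ⟨rfl, rfl⟩⟩

theorem advance (h : AtLocus T α p j v y) (hj : j < p.length) (hv : j < v.length)
    (heq : p[j] = v[j]) : AtLocus T α p (j + 1) v y := by
  refine ⟨h.isNode, ?_, Or.inr ?_⟩
  · have h1 : p.take j = v.take j := by
      have := h.take_prefix
      rw [List.prefix_iff_eq_take] at this
      simpa [hj.le] using this
    rw [List.take_succ_eq_append_getElem hj, h1, heq, ← List.take_succ_eq_append_getElem hv]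
    exact List.take_prefix _ _
  · rcases h.edge with ⟨rfl, -⟩ | ⟨⟨u, a, he, hu⟩, h2⟩
    · simp at hv
    · exact ⟨⟨u, a, he, by omega⟩, h2⟩

/-- At least one letter of the incoming edge has been matched, so `p` enters this edge. If `p` were
a factor, one of `p` and `v` would be a prefix of the other, and they would agree at `j`. -/
theorem not_inLayer_of_ne (h : AtLocus T α p j v y) (hj : j < p.length) (hv : j < v.length)
    (hne : p[j] ≠ v[j]) : ¬ InLayer T α p := by
  intro hp
  rcases h.edge with ⟨rfl, -⟩ | ⟨⟨u, a, he, hu⟩, -⟩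
  · simp at hv
  · have h1 : u ++ [a] <+: p.take j :=
      List.prefix_of_prefix_length_le he.2.2.1 h.take_prefix (by simp; omega)
    rcases he.prefix_or_prefix (h1.trans (List.take_prefix _ _)) hp with hpv | hvp
    · exact hne (hpv.getElem hj)
    · exact hne (hvp.getElem hv).symm

theorem eq_take (h : AtLocus T α p j v y) (hj : j ≤ p.length) (hv : v.length ≤ j) :
    v = p.take j :=
  (h.take_prefix.eq_of_length_le (by simp; omega)).symm

theorem descend (h : AtLocus T α p j v y) (hj : j < p.length) (hv : v.length ≤ j)
    {v' : List A} {y' : ℕ} (he : IsEdge (window T α) v p[j] v')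
    (hy : windowStart T α ≤ y') (hy' : v' <+: T.drop y') : AtLocus T α p (j + 1) v' y' := by
  have hvt := h.eq_take hj.le hv
  refine ⟨he.2.1, ?_, Or.inr ⟨⟨v, _, he, by omega⟩, hy, hy'⟩⟩
  rw [List.take_succ_eq_append_getElem hj, ← hvt]
  exact he.2.2.1

theorem not_inLayer_of_not_isEdge (h : AtLocus T α p j v y) (hj : j < p.length)
    (hv : v.length ≤ j) (he : ¬ ∃ v', IsEdge (window T α) v p[j] v') : ¬ InLayer T α p := by
  intro hp
  refine he (exists_isEdge h.isNode ?_)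
  rw [h.eq_take hj.le hv, ← List.take_succ_eq_append_getElem hj]
  exact (List.take_prefix _ _).isInfix.trans hp

theorem occurs (h : AtLocus T α p p.length v y) (hp : p ≠ []) :
    windowStart T α ≤ y ∧ p <+: T.drop y := by
  rcases h.edge with ⟨-, h0⟩ | ⟨-, hy, hv⟩
  · exact absurd (List.length_eq_zero_iff.mp h0) hp
  · exact ⟨hy, by simpa using h.take_prefix.trans hv⟩

end AtLocus

end Combinatorics

/-! ### Layer sizes and correctness of the answer -/

section Layers

variable {bitlen : ℕ → ℕ} {n : ℕ}

theorem swOf_le (bitlen : ℕ → ℕ) (n b : ℕ) : swOf bitlen n b ≤ n := by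
  refine Finset.sup_le fun j hj => ?_
  simp only [Finset.mem_filter, Finset.mem_range] at hj
  simp only [id]; omega

theorem le_swOf {b x : ℕ} (hx : x ≤ n) (hb : bitlen x ≤ b) : x ≤ swOf bitlen n b :=
  Finset.le_sup (f := id) (by simp; omega)

/-- The witness `x` makes the filtered set non-empty, so its supremum is attained; otherwise it
would be the default `0`. -/
theorem bitlen_swOf_le {b x : ℕ} (hx : x ≤ n) (hb : bitlen x ≤ b) :
    bitlen (swOf bitlen n b) ≤ b := by
  obtain ⟨y, hy, hy'⟩ := Finset.exists_mem_eq_sup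
    ((Finset.range (n + 1)).filter (fun j => bitlen j ≤ b))
    ⟨x, by simp; omega⟩ id
  unfold swOf
  rw [hy']
  exact (Finset.mem_filter.mp hy).2

theorem swOf_mem_SW {x : ℕ} (hx : x ≤ n) : swOf bitlen n (bitlen x) ∈ SW bitlen n :=
  Finset.mem_image_of_mem _ (Finset.mem_image_of_mem _ (by simp; omega))

theorem le_of_mem_SW {α : ℕ} (h : α ∈ SW bitlen n) : α ≤ n := by
  obtain ⟨b, -, rfl⟩ := Finset.mem_image.mp h
  exact swOf_le _ _ _

/-- The window of size `n` is the whole text, so a pattern absent from all layers does not occur. -/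
theorem self_mem_SW (bitlen : ℕ → ℕ) (n : ℕ) : n ∈ SW bitlen n := by
  have := swOf_mem_SW (bitlen := bitlen) (le_refl n)
  rwa [le_antisymm (swOf_le _ _ _) (le_swOf le_rfl le_rfl)] at this

/-- An occurrence in the smallest layer answers the query. -/
theorem isREP_of_minimal {A : Type} (hmono : Monotone bitlen) {T p : List A} (hp : p ≠ [])
    {α y : ℕ} (hmin : ∀ β ∈ SW bitlen T.length, InLayer T β p → α ≤ β)
    (hy : windowStart T α ≤ y) (hpy : p <+: T.drop y) : IsREP bitlen T p (y + 1) := by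
  classical
  have hylt := lt_length_of_prefix_drop hp hpy
  have hex : ∃ x, x ∈ Offset T p := ⟨_, y, ⟨hylt, hpy⟩, rfl⟩
  refine Or.inr ⟨y, ⟨hylt, hpy⟩, rfl, Nat.find hex, ⟨Nat.find_spec hex,
    fun x hx => Nat.find_min' hex hx⟩, le_antisymm ?_ (hmono (Nat.find_min' hex
      ⟨y, ⟨hylt, hpy⟩, rfl⟩))⟩
  obtain ⟨z, ⟨hz, hpz⟩, hzx⟩ := Nat.find_spec hex
  have hxn : Nat.find hex ≤ T.length := by rw [← hzx]; unfold offset; omega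
  set x := Nat.find hex
  -- The layer for `bitlen x` contains the rightmost occurrence, so it bounds `α` and with it the
  -- offset of `y`.
  have hxβ : x ≤ swOf bitlen T.length (bitlen x) := le_swOf hxn le_rfl
  have hαβ : α ≤ swOf bitlen T.length (bitlen x) := by
    refine hmin _ (swOf_mem_SW hxn) (inLayer_iff.mpr ⟨z, ?_, hpz⟩)
    unfold offset at hzx
    unfold windowStart
    omega
  refine (hmono ?_).trans (bitlen_swOf_le hxn le_rfl)
  unfold windowStart at hy
  unfold offset
  omega

theorem isREP_zero {A : Type} {T p : List A}
    (h : ∀ β ∈ SW bitlen T.length, ¬ InLayer T β p) : IsREP bitlen T p 0 := by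
  refine Or.inl ⟨Set.eq_empty_of_forall_notMem fun y hy => ?_, rfl⟩
  refine h _ (self_mem_SW bitlen T.length) (inLayer_iff.mpr ⟨y, ?_, hy.2⟩)
  unfold windowStart
  omega

end Layers


section Query

/-! ## The query program

Registers: `5`, `6`, `7` are the bounds and the midpoint of the binary search, `8` is the answer;
`9` is the number of matched letters, `10`, `11`, `12` are the address, the string depth and the
occurrence of the current node; `13`, `14` are scratch; `15` and `16` hold `1` and `0`. -/

/-- Abandon the descent. -/
def failProg : Program := .add 9 4 15

/-- Match the next letter of the pattern, in register `13`, on the incoming edge of the node. -/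
def matchProg : Program :=
  .seq (.add 14 12 9) <| .seq (.add 14 0 14) <| .seq (.load 14 14) <|
    .ifLt 13 14 failProg <| .ifLt 14 13 failProg <| .add 9 9 15

/-- Descend from the node to the child for the next letter of the pattern. -/
def childProg : Program :=
  .seq (.add 14 10 13) <| .seq (.add 14 14 15) <| .seq (.add 14 14 15) <| .seq (.load 14 14) <|
    .ifLt 16 14
      (.seq (.copy 10 14) <| .seq (.load 11 10) <| .seq (.add 14 10 15) <| .seq (.load 12 14) <|
        .seq (.sub 12 12 9) <| .add 9 9 15)
      failProg

/-- Process one letter of the pattern. -/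
def letterProg : Program :=
  .seq (.add 13 3 9) <| .seq (.load 13 13) <| .ifLt 9 11 matchProg childProg

/-- Search the pattern in the suffix tree with index in register `7`. -/
def descentProg : Program :=
  .seq (.add 13 1 7) <| .seq (.load 10 13) <| .seq (.load 11 10) <| .seq (.const 12 0) <|
    .seq (.const 9 0) <| .whileLt 9 4 letterProg

/-- One step of the binary search. -/
def halvingProg : Program :=
  .seq (.add 7 5 6) <| .seq (.half 7 7) <| .seq descentProg <|
    .ifLt 4 9 (.add 5 7 15) (.seq (.copy 6 7) (.add 8 12 15))

/-- Answer the query by a binary search for the smallest layer containing the pattern. -/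
def queryProg : Program :=
  .seq (.const 15 1) <| .seq (.const 16 0) <| .seq (.const 5 0) <| .seq (.copy 6 2) <|
    .seq (.const 8 0) <| .seq (.whileLt 5 6 halvingProg) <| .copy 0 8

/-! ### Correctness and running time of the program -/

@[simp] theorem State.setReg_reg (s : State) (x n r : ℕ) :
    (s.setReg x n).reg r = if r = x then n else s.reg r := by
  simp [State.setReg, Function.update_apply]

@[simp] theorem State.setReg_mem (s : State) (x n : ℕ) : (s.setReg x n).mem = s.mem := rfl

/-- The memory and the registers outside of `l, …, h` are the same. -/
def Preserves (l h : ℕ) (s s' : State) : Prop :=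
  s'.mem = s.mem ∧ ∀ r, r < l ∨ h < r → s'.reg r = s.reg r

theorem Preserves.refl (l h : ℕ) (s : State) : Preserves l h s s := ⟨rfl, fun _ _ => rfl⟩

theorem Preserves.trans {l h : ℕ} {s₁ s₂ s₃ : State} (h₁ : Preserves l h s₁ s₂)
    (h₂ : Preserves l h s₂ s₃) : Preserves l h s₁ s₃ :=
  ⟨h₂.1.trans h₁.1, fun r hr => (h₂.2 r hr).trans (h₁.2 r hr)⟩

theorem Preserves.setReg {l h : ℕ} {s s' : State} (hs : Preserves l h s s') {x : ℕ} (hl : l ≤ x)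
    (hh : x ≤ h) (n : ℕ) : Preserves l h s (s'.setReg x n) := by
  refine ⟨hs.1, fun r hr => ?_⟩
  rw [State.setReg_reg, if_neg (by omega), hs.2 r hr]

theorem Preserves.widen {l h l' h' : ℕ} {s s' : State} (hs : Preserves l h s s') (hl : l' ≤ l)
    (hh : h ≤ h') : Preserves l' h' s s' := ⟨hs.1, fun r hr => hs.2 r (by omega)⟩

variable {σ : ℕ}

/-- The text, the pattern and the constants are in their places. -/
structure Ready (T p : List (Fin σ)) (s : State) : Prop where
  text : StoresWord s.mem (s.reg 0) T
  pattern : StoresPattern p s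
  one : s.reg 15 = 1
  zero : s.reg 16 = 0

theorem Ready.of_preserves {T p : List (Fin σ)} {l h : ℕ} {s s' : State} (hs : Ready T p s)
    (hp : Preserves l h s s') (hl : 4 < l) (hh : h < 15) : Ready T p s' := by
  obtain ⟨h1, ⟨h2, h3⟩, h4, h5⟩ := hs
  obtain ⟨hm, hr⟩ := hp
  refine ⟨?_, ⟨?_, ?_⟩, ?_, ?_⟩
  · rwa [hm, hr 0 (by omega)]
  · rwa [hm, hr 3 (by omega)]
  · rwa [hr 4 (by omega)]
  · rwa [hr 15 (by omega)]
  · rwa [hr 16 (by omega)]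

/-- The records of the nodes of the suffix tree of a window are at the addresses `addr`. -/
structure TreeAt (mem : ℕ → ℕ) (T : List (Fin σ)) (α : ℕ) (addr : List (Fin σ) → ℕ) : Prop where
  node : ∀ v, IsNode (window T α) v → addr v ≠ 0 ∧ mem (addr v) = v.length
  edge : ∀ u a v, IsEdge (window T α) u a v → mem (addr u + 2 + (a : ℕ)) = addr v ∧
    ∃ y, windowStart T α ≤ y ∧ v <+: T.drop y ∧ mem (addr v + 1) = y + u.length
  no_edge : ∀ u a, IsNode (window T α) u → (¬ ∃ v, IsEdge (window T α) u a v) →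
    mem (addr u + 2 + (a : ℕ)) = 0

/-- The registers represent the locus `v` with `j` matched letters. -/
structure RegsAt (T : List (Fin σ)) (α : ℕ) (p : List (Fin σ)) (addr : List (Fin σ) → ℕ)
    (j : ℕ) (v : List (Fin σ)) (s : State) : Prop where
  atLocus : AtLocus T α p j v (s.reg 12)
  matched : s.reg 9 = j
  address : s.reg 10 = addr v
  depth : s.reg 11 = v.length

variable {T p : List (Fin σ)} {α j : ℕ} {addr : List (Fin σ) → ℕ} {v : List (Fin σ)} {s : State}

/-- The outcome of processing the letter number `j`. -/
def LetterPost (T : List (Fin σ)) (α : ℕ) (p : List (Fin σ)) (addr : List (Fin σ) → ℕ) (j : ℕ)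
    (s' : State) : Prop :=
  (∃ v', RegsAt T α p addr (j + 1) v' s') ∨ (s'.reg 9 = p.length + 1 ∧ ¬ InLayer T α p)

theorem run_matchProg (hs : Ready T p s) (hr : RegsAt T α p addr j v s)
    (hj : j < p.length) (hv : j < v.length) (h13 : s.reg 13 = (p[j] : ℕ)) :
    ∃ s' t, Run matchProg s s' t ∧ t ≤ 6 ∧ Preserves 9 14 s s' ∧ LetterPost T α p addr j s' := by
  obtain ⟨hloc, h9, h10, h11⟩ := hr
  -- Register `12` holds an occurrence of the whole node `v`, so its letters can be read from the
  -- text.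
  have hletter : s.mem (s.reg 0 + (s.reg 12 + j)) = (v[j] : ℕ) := by
    rcases hloc.edge with ⟨rfl, -⟩ | ⟨-, -, hvT⟩
    · simp at hv
    · have h1 := hvT.getElem hv
      have h2 := hvT.length_le
      rw [List.length_drop] at h2
      rw [hs.text (s.reg 12 + j) (by omega), h1, List.getElem_drop]
  have h4 := hs.pattern.2
  have h15 := hs.one
  by_cases heq : p[j] = v[j]
  · refine ⟨_, _, .seq (.add ..) (.seq (.add ..) (.seq (.load ..) (.ifFalse ?_ (.ifFalse ?_
      (.add ..))))), by norm_num, ?_, Or.inl ⟨v, ?_, ?_, ?_, ?_⟩⟩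
    · simp [h13, h9, hletter, heq]
    · simp [h13, h9, hletter, heq]
    · exact ((((Preserves.refl 9 14 s).setReg (by norm_num) (by norm_num) _).setReg (by norm_num)
        (by norm_num) _).setReg (by norm_num) (by norm_num) _).setReg (by norm_num)
        (by norm_num) _
    · simpa using hloc.advance hj hv heq
    · simp [h9, h15]
    · simpa using h10
    · simpa using h11
  · have hnot := hloc.not_inLayer_of_ne hj hv heq
    have hne : (p[j] : ℕ) ≠ v[j] := fun h => heq (Fin.ext h)
    rcases lt_or_gt_of_ne hne with hlt | hgt
    · refine ⟨_, _, .seq (.add ..) (.seq (.add ..) (.seq (.load ..) (.ifTrue ?_ (.add ..)))),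
        by norm_num, ?_, Or.inr ⟨?_, hnot⟩⟩
      · simpa [h13, h9, hletter] using hlt
      · exact ((((Preserves.refl 9 14 s).setReg (by norm_num) (by norm_num) _).setReg
          (by norm_num) (by norm_num) _).setReg (by norm_num) (by norm_num) _).setReg
          (by norm_num) (by norm_num) _
      · simp [h4, h15]
    · refine ⟨_, _, .seq (.add ..) (.seq (.add ..) (.seq (.load ..) (.ifFalse ?_ (.ifTrue ?_
        (.add ..))))), by norm_num, ?_, Or.inr ⟨?_, hnot⟩⟩
      · simpa [h13, h9, hletter] using hgt.le
      · simpa [h13, h9, hletter] using hgt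
      · exact ((((Preserves.refl 9 14 s).setReg (by norm_num) (by norm_num) _).setReg
          (by norm_num) (by norm_num) _).setReg (by norm_num) (by norm_num) _).setReg
          (by norm_num) (by norm_num) _
      · simp [h4, h15]

theorem run_childProg (hs : Ready T p s) (htree : TreeAt s.mem T α addr)
    (hr : RegsAt T α p addr j v s) (hj : j < p.length) (hv : v.length ≤ j)
    (h13 : s.reg 13 = (p[j] : ℕ)) :
    ∃ s' t, Run childProg s s' t ∧ t ≤ 11 ∧ Preserves 9 14 s s' ∧ LetterPost T α p addr j s' := by
  obtain ⟨hloc, h9, h10, h11⟩ := hr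
  have h4 := hs.pattern.2
  have h15 := hs.one
  have h16 := hs.zero
  have haddr : addr v + (p[j] : ℕ) + 1 + 1 = addr v + 2 + (p[j] : ℕ) := by omega
  by_cases he : ∃ v', IsEdge (window T α) v p[j] v'
  · obtain ⟨v', he⟩ := he
    obtain ⟨hchild, y, hy, hvy, hpos⟩ := htree.edge _ _ _ he
    obtain ⟨hne, hdepth⟩ := htree.node v' he.2.1
    -- The child's record stores `y + v.length`; as the number of matched letters equals this depth,
    -- subtracting register `9` recovers the occurrence `y`.
    have hvj : v.length = j := by
      have := congrArg List.length (hloc.eq_take hj.le hv)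
      rw [List.length_take] at this
      omega
    refine ⟨_, _, .seq (.add ..) (.seq (.add ..) (.seq (.add ..) (.seq (.load ..) (.ifTrue ?_
      (.seq (.copy ..) (.seq (.load ..) (.seq (.add ..) (.seq (.load ..) (.seq (.sub ..)
      (.add ..)))))))))), by norm_num, ?_, Or.inl ⟨v', ?_, ?_, ?_, ?_⟩⟩
    · simpa [h10, h13, h15, h16, haddr, hchild] using Nat.pos_of_ne_zero hne
    · refine ⟨rfl, fun r hr => ?_⟩
      have : r ≠ 9 ∧ r ≠ 10 ∧ r ≠ 11 ∧ r ≠ 12 ∧ r ≠ 14 := by omega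
      simp [this]
    · simpa [h9, h10, h13, h15, haddr, hchild, hpos, hvj] using hloc.descend hj hv he hy hvy
    · simp [h9, h15]
    · simp [h10, h13, h15, haddr, hchild]
    · simp [h10, h13, h15, haddr, hchild, hdepth]
  · have hnil := htree.no_edge _ _ hloc.isNode he
    refine ⟨_, _, .seq (.add ..) (.seq (.add ..) (.seq (.add ..) (.seq (.load ..) (.ifFalse ?_
      (.add ..))))), by norm_num, ?_, Or.inr ⟨?_, hloc.not_inLayer_of_not_isEdge hj hv he⟩⟩
    · simp [h10, h13, h15, h16, haddr, hnil]
    · refine ⟨rfl, fun r hr => ?_⟩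
      have : r ≠ 9 ∧ r ≠ 14 := by omega
      simp [this]
    · simp [h4, h15]

theorem run_letterProg (hs : Ready T p s) (htree : TreeAt s.mem T α addr)
    (hr : RegsAt T α p addr j v s) (hj : j < p.length) :
    ∃ s' t, Run letterProg s s' t ∧ t ≤ 14 ∧ Preserves 9 14 s s' ∧
      LetterPost T α p addr j s' := by
  let s₁ := (s.setReg 13 (s.reg 3 + s.reg 9)).setReg 13 (s.mem (s.reg 3 + s.reg 9))
  have hs₁ : Preserves 9 14 s s₁ :=
    ((Preserves.refl 9 14 s).setReg (by norm_num) (by norm_num) _).setReg (by norm_num)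
      (by norm_num) _
  have hready : Ready T p s₁ := hs.of_preserves hs₁ (by norm_num) (by norm_num)
  have h13 : s₁.reg 13 = (p[j] : ℕ) := by
    simpa [s₁, hr.matched] using hs.pattern.1 j hj
  have hr₁ : RegsAt T α p addr j v s₁ :=
    ⟨by simpa [s₁] using hr.atLocus, by simpa [s₁] using hr.matched,
      by simpa [s₁] using hr.address, by simpa [s₁] using hr.depth⟩
  have hrun : ∀ {c s' t}, Run c s₁ s' t →
      Run (.seq (.add 13 3 9) (.seq (.load 13 13) c)) s s' (1 + (1 + t)) := by
    intro c s' t hc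
    refine .seq (.add ..) (.seq (.load ..) ?_)
    simpa [s₁] using hc
  by_cases hv : j < v.length
  · obtain ⟨s', t, hrun', ht, hp, hpost⟩ := run_matchProg hready hr₁ hj hv h13
    refine ⟨s', _, hrun (.ifTrue ?_ hrun'), by omega, hs₁.trans hp, hpost⟩
    rw [hr₁.matched, hr₁.depth]; exact hv
  · obtain ⟨s', t, hrun', ht, hp, hpost⟩ :=
      run_childProg hready (α := α) (by simpa [s₁] using htree) hr₁ hj (not_lt.mp hv) h13
    refine ⟨s', _, hrun (.ifFalse ?_ hrun'), by omega, hs₁.trans hp, hpost⟩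
    rw [hr₁.matched, hr₁.depth]; exact hv

/-- The outcome of the search in one layer. -/
def DescentPost (T : List (Fin σ)) (α : ℕ) (p : List (Fin σ)) (s' : State) : Prop :=
  (s'.reg 9 = p.length ∧ windowStart T α ≤ s'.reg 12 ∧ p <+: T.drop (s'.reg 12)) ∨
    (s'.reg 9 = p.length + 1 ∧ ¬ InLayer T α p)

/-- The value `p.length + 1` in register `9` both ends the loop and distinguishes failure from a
full match. -/
theorem run_letterLoop (hp : p ≠ []) (hs : Ready T p s) (htree : TreeAt s.mem T α addr)
    (hr : RegsAt T α p addr j v s) (hj : j ≤ p.length) :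
    ∃ s' t, Run (.whileLt 9 4 letterProg) s s' t ∧ t ≤ 15 * (p.length - j) + 1 ∧
      Preserves 9 14 s s' ∧ DescentPost T α p s' := by
  induction hn : p.length - j generalizing j v s with
  | zero =>
    obtain rfl : j = p.length := by omega
    refine ⟨s, _, .whileFalse ?_, by norm_num, .refl _ _ _, Or.inl ⟨hr.matched, ?_⟩⟩
    · rw [hr.matched, hs.pattern.2]; exact lt_irrefl _
    · exact hr.atLocus.occurs hp
  | succ n ih =>
    obtain ⟨s₁, t₁, hrun₁, ht₁, hp₁, hpost⟩ := run_letterProg hs htree hr (by omega)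
    have hs₁ := hs.of_preserves hp₁ (by norm_num) (by norm_num)
    have hlt : s.reg 9 < s.reg 4 := by rw [hr.matched, hs.pattern.2]; omega
    rcases hpost with ⟨v', hr'⟩ | ⟨h9, hnot⟩
    · obtain ⟨s₂, t₂, hrun₂, ht₂, hp₂, hpost₂⟩ :=
        ih hs₁ (by rwa [hp₁.1]) hr' (by omega) (by omega)
      exact ⟨s₂, _, .whileTrue hlt hrun₁ hrun₂, by omega, hp₁.trans hp₂, hpost₂⟩
    · refine ⟨s₁, _, .whileTrue hlt hrun₁ (.whileFalse ?_), by omega, hp₁, Or.inr ⟨h9, hnot⟩⟩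
      rw [h9, hs₁.pattern.2]; omega

theorem run_descentProg (hp : p ≠ []) (hs : Ready T p s)
    (htree : StoresSuffixTree s.mem T α (s.mem (s.reg 1 + s.reg 7))) :
    ∃ s' t, Run descentProg s s' t ∧ t ≤ 15 * p.length + 6 ∧
      Preserves 9 14 s s' ∧ DescentPost T α p s' := by
  obtain ⟨addr, hroot, -, hnode, hedge, hno⟩ := htree
  let s₁ := ((((s.setReg 13 (s.reg 1 + s.reg 7)).setReg 10 (s.mem (s.reg 1 + s.reg 7))).setReg 11
    (s.mem (s.mem (s.reg 1 + s.reg 7)))).setReg 12 0).setReg 9 0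
  have hs₁ : Preserves 9 14 s s₁ := by
    refine ⟨rfl, fun r hr => ?_⟩
    have : r ≠ 9 ∧ r ≠ 10 ∧ r ≠ 11 ∧ r ≠ 12 ∧ r ≠ 13 := by omega
    simp [s₁, this]
  have hr₁ : RegsAt T α p addr 0 [] s₁ :=
    ⟨.root _ _ _ _, by simp [s₁], by simp [s₁, hroot], by
      simpa [s₁, hroot] using (hnode [] (Or.inl rfl)).2⟩
  obtain ⟨s', t, hrun, ht, hp', hpost⟩ := run_letterLoop hp
    (hs.of_preserves hs₁ (by norm_num) (by norm_num)) (α := α) (addr := addr)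
    (by rw [hs₁.1]; exact ⟨hnode, hedge, hno⟩) hr₁ (Nat.zero_le _)
  refine ⟨s', _, .seq (.add ..) (.seq (.load ..) (.seq (.load ..) (.seq (.const ..) (.seq
    (t₂ := t) (.const ..) ?_)))), ?_, hs₁.trans hp', hpost⟩
  · simpa [s₁] using hrun
  · omega

theorem StoresMLST.of_preserves {bitlen : ℕ → ℕ} {l h : ℕ} {s' : State}
    (hs : StoresMLST bitlen T s) (hp : Preserves l h s s') (hl : 2 < l) :
    StoresMLST bitlen T s' := by
  obtain ⟨hm, hr⟩ := hp
  unfold StoresMLST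
  rw [hm, hr 0 (by omega), hr 1 (by omega), hr 2 (by omega)]
  exact hs

/-- The invariant of the binary search: the pattern is in none of the layers below register `5`,
and the layer in register `6`, if it exists, contains the occurrence described by register `8`. -/
structure SearchInv (bitlen : ℕ → ℕ) (T p : List (Fin σ)) (s : State) : Prop where
  ready : Ready T p s
  stores : StoresMLST bitlen T s
  le : s.reg 5 ≤ s.reg 6
  le_length : s.reg 6 ≤ (swList bitlen T.length).length
  below : ∀ (m : ℕ) (h : m < (swList bitlen T.length).length), m < s.reg 5 →
    ¬ InLayer T (swList bitlen T.length)[m] p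
  found : (s.reg 6 = (swList bitlen T.length).length ∧ s.reg 8 = 0) ∨
    ∃ (h : s.reg 6 < (swList bitlen T.length).length) (y : ℕ), s.reg 8 = y + 1 ∧
      windowStart T (swList bitlen T.length)[s.reg 6] ≤ y ∧ p <+: T.drop y

theorem swList_length (bitlen : ℕ → ℕ) (n : ℕ) :
    (swList bitlen n).length = (SW bitlen n).card := Finset.length_sort _

theorem swList_mono (bitlen : ℕ → ℕ) (n : ℕ) {m m' : ℕ} (h : m ≤ m')
    (hm' : m' < (swList bitlen n).length) :
    (swList bitlen n)[m] ≤ (swList bitlen n)[m'] :=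
  (Finset.sortedLT_sort (SW bitlen n)).sortedLE.getElem_le_getElem_of_le h

/-- Success makes the midpoint the upper bound; failure excludes it together with all smaller
layers. The width is at least halved, rounding down, in both cases. -/
theorem run_halvingProg {bitlen : ℕ → ℕ} (hp : p ≠ []) (hs : SearchInv bitlen T p s)
    (hlt : s.reg 5 < s.reg 6) :
    ∃ s' t, Run halvingProg s s' t ∧ t ≤ 15 * p.length + 11 ∧ Preserves 5 14 s s' ∧
      SearchInv bitlen T p s' ∧ s'.reg 6 - s'.reg 5 ≤ (s.reg 6 - s.reg 5) / 2 := by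
  obtain ⟨hready, hst, hle, hlen, hbelow, hfound⟩ := hs
  let m := (s.reg 5 + s.reg 6) / 2
  have hm : m < (swList bitlen T.length).length := by omega
  let s₁ := (s.setReg 7 (s.reg 5 + s.reg 6)).setReg 7 m
  have hs₁ : Preserves 5 14 s s₁ :=
    ((Preserves.refl 5 14 s).setReg (by norm_num) (by norm_num) _).setReg (by norm_num)
      (by norm_num) _
  have hrdy₁ := hready.of_preserves hs₁ (by norm_num) (by norm_num)
  have h7 : s₁.reg 7 = m := by simp [s₁]
  have htree : StoresSuffixTree s₁.mem T (swList bitlen T.length)[m]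
      (s₁.mem (s₁.reg 1 + s₁.reg 7)) := by
    rw [h7]
    exact (hst.of_preserves hs₁ (by norm_num)).2.2 m hm
  obtain ⟨s₂, t, hrun, ht, hs₂, hpost⟩ := run_descentProg hp hrdy₁ htree
  have hs₁₂ : Preserves 5 14 s s₂ := hs₁.trans (hs₂.widen (by norm_num) le_rfl)
  have hrdy₂ := hready.of_preserves hs₁₂ (by norm_num) (by norm_num)
  have h2 : s₂.reg 5 = s.reg 5 ∧ s₂.reg 6 = s.reg 6 ∧ s₂.reg 7 = m ∧ s₂.reg 8 = s.reg 8 := by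
    refine ⟨?_, ?_, ?_, ?_⟩ <;> rw [hs₂.2 _ (by norm_num)] <;> simp [s₁]
  obtain ⟨h25, h26, h27, h28⟩ := h2
  have h4 := hrdy₂.pattern.2
  have h15 := hrdy₂.one
  have hrun' : ∀ {c s' t'}, Run c s₂ s' t' → Run (.seq (.add 7 5 6) <| .seq (.half 7 7) <|
      .seq descentProg c) s s' (1 + (1 + (t + t'))) := by
    intro c s' t' hc
    refine .seq (.add ..) (.seq (.half ..) (.seq ?_ hc))
    simpa [s₁, m] using hrun
  rcases hpost with ⟨h9, hy, hpy⟩ | ⟨h9, hnot⟩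
  · have hs' : Preserves 5 14 s ((s₂.setReg 6 (s₂.reg 7)).setReg 8
        (s₂.reg 12 + s₂.reg 15)) :=
      (hs₁₂.setReg (by norm_num) (by norm_num) _).setReg (by norm_num) (by norm_num) _
    refine ⟨(s₂.setReg 6 (s₂.reg 7)).setReg 8 (s₂.reg 12 + s₂.reg 15), _,
      hrun' (.ifFalse ?_ (.seq (t₂ := 1) (.copy ..) ?_)), ?_, hs', ⟨hready.of_preserves hs' (by norm_num)
      (by norm_num), hst.of_preserves hs' (by norm_num), ?_, ?_, ?_, Or.inr ?_⟩, ?_⟩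
    · omega
    · simpa using Run.add (s₂.setReg 6 (s₂.reg 7)) 8 12 15
    · omega
    · simp [h25, h27]; omega
    · simp [h27]; omega
    · simpa [h25] using hbelow
    · refine ⟨by simpa [h27] using hm, s₂.reg 12, by simp [h15], ?_, hpy⟩
      simpa [h27] using hy
    · simp [h25, h27]; omega
  · have hs' : Preserves 5 14 s (s₂.setReg 5 (s₂.reg 7 + s₂.reg 15)) :=
      hs₁₂.setReg (by norm_num) (by norm_num) _
    refine ⟨_, _, hrun' (.ifTrue ?_ (.add ..)), ?_, hs', ⟨hready.of_preserves hs' (by norm_num)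
      (by norm_num), hst.of_preserves hs' (by norm_num), ?_, ?_, ?_, ?_⟩, ?_⟩
    · omega
    · omega
    · simp [h26, h27, h15]; omega
    · simpa [h26] using hlen
    · intro m' hm' hlt' hin
      simp only [State.setReg_reg, if_true, h27, h15] at hlt'
      exact hnot (hin.mono (swList_mono bitlen T.length (by omega) hm))
    · simpa [h26, h28] using hfound
    · simp [h26, h27, h15]; omega

theorem run_searchLoop {bitlen : ℕ → ℕ} (hp : p ≠ []) (hs : SearchInv bitlen T p s) (k : ℕ)
    (hk : s.reg 6 - s.reg 5 < 2 ^ k) :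
    ∃ s' t, Run (.whileLt 5 6 halvingProg) s s' t ∧ t ≤ (15 * p.length + 12) * k + 1 ∧
      Preserves 5 14 s s' ∧ SearchInv bitlen T p s' ∧ s'.reg 5 = s'.reg 6 := by
  induction k generalizing s with
  | zero =>
    have := hs.le
    simp only [pow_zero] at hk
    exact ⟨s, _, .whileFalse (by omega), by norm_num, .refl _ _ _, hs, by omega⟩
  | succ k ih =>
    by_cases hlt : s.reg 5 < s.reg 6
    · obtain ⟨s₁, t₁, hrun₁, ht₁, hp₁, hs₁, hhalf⟩ := run_halvingProg hp hs hlt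
      obtain ⟨s₂, t₂, hrun₂, ht₂, hp₂, hs₂, heq⟩ := ih hs₁ (by rw [pow_succ] at hk; omega)
      refine ⟨s₂, _, .whileTrue hlt hrun₁ hrun₂, ?_, hp₁.trans hp₂, hs₂, heq⟩
      rw [mul_add]; omega
    · have := hs.le
      exact ⟨s, _, .whileFalse hlt, by omega, .refl _ _ _, hs, by omega⟩

theorem run_queryProg {bitlen : ℕ → ℕ} (hmono : Monotone bitlen) (hp : p ≠ [])
    (hst : StoresMLST bitlen T s) (hpat : StoresPattern p s) :
    ∃ s' t, Run queryProg s s' t ∧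
      t ≤ (15 * p.length + 12) * (Nat.log 2 (SW bitlen T.length).card + 1) + 7 ∧
      s'.mem = s.mem ∧ IsREP bitlen T p (s'.reg 0) ∧
      ∀ y, s'.reg 0 = y + 1 → ∀ α ∈ SW bitlen T.length, InLayer T α p → windowStart T α ≤ y := by
  let s₁ := ((((s.setReg 15 1).setReg 16 0).setReg 5 0).setReg 6 (s.reg 2)).setReg 8 0
  have hs₁ : Preserves 5 16 s s₁ := by
    refine ⟨rfl, fun r hr => ?_⟩
    have : r ≠ 5 ∧ r ≠ 6 ∧ r ≠ 8 ∧ r ≠ 15 ∧ r ≠ 16 := by omega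
    simp [s₁, this]
  have hst₁ := hst.of_preserves hs₁ (by norm_num)
  have hinv : SearchInv bitlen T p s₁ := by
    refine ⟨⟨hst₁.1, ?_, by simp [s₁], by simp [s₁]⟩, hst₁, by simp [s₁], ?_, ?_, Or.inl ?_⟩
    · simpa [StoresPattern, s₁] using hpat
    · simp [s₁, hst.2.1]
    · simp [s₁]
    · simp [s₁, hst.2.1]
  obtain ⟨s₂, t, hrun, ht, hs₂, hinv₂, heq⟩ := run_searchLoop hp hinv
    (Nat.log 2 (SW bitlen T.length).card + 1) (by
      have := Nat.lt_pow_succ_log_self (b := 2) (by norm_num) (SW bitlen T.length).card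
      rw [← swList_length, ← hst.2.1] at this
      rw [← swList_length, ← hst.2.1]
      simpa [s₁] using this)
  refine ⟨s₂.setReg 0 (s₂.reg 8), _, .seq (.const ..) (.seq (.const ..) (.seq (.const ..) (.seq
    (.copy ..) (.seq (.const ..) (.seq (t₁ := t) ?_ (.copy ..)))))), ?_, ?_, ?_⟩
  · simpa [s₁] using hrun
  · omega
  · rw [State.setReg_mem, hs₂.1, hs₁.1]
  -- The bounds have met, so every layer containing the pattern has index at least register `6`.
  have hnot : ∀ α ∈ SW bitlen T.length, InLayer T α p →
      ∃ m, ∃ h : m < (swList bitlen T.length).length, (swList bitlen T.length)[m] = α ∧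
        s₂.reg 6 ≤ m := by
    intro α hα hin
    obtain ⟨m, hm, rfl⟩ := List.mem_iff_getElem.mp ((Finset.mem_sort (· ≤ ·)).mpr hα)
    refine ⟨m, hm, rfl, ?_⟩
    by_contra! hlt
    exact hinv₂.below m hm (by omega) hin
  simp only [State.setReg_reg, if_true]
  rcases hinv₂.found with ⟨h6, h8⟩ | ⟨h6, y, h8, hy, hpy⟩
  · rw [h8]
    refine ⟨isREP_zero fun β hβ hin => ?_, fun y hy => by omega⟩
    obtain ⟨m, hm, -, hle⟩ := hnot β hβ hin
    omega
  · have hmin : ∀ β ∈ SW bitlen T.length, InLayer T β p →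
        (swList bitlen T.length)[s₂.reg 6] ≤ β := by
      intro β hβ hin
      obtain ⟨m, hm, rfl, hle⟩ := hnot β hβ hin
      exact swList_mono _ _ hle hm
    rw [h8]
    refine ⟨isREP_of_minimal hmono hp hmin hy hpy, fun y' hy' α hα hin => ?_⟩
    obtain rfl : y = y' := by omega
    exact (windowStart_anti T (hmin α hα hin)).trans hy

end Query

/-! ### The number of layers is logarithmic -/

section CardBound

variable {bitlen : ℕ → ℕ}

theorem card_SW_le_bitlen (hmono : Monotone bitlen) (i : ℕ) :
    (SW bitlen i).card ≤ bitlen i + 1 := by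
  refine Finset.card_image_le.trans ?_
  calc (B bitlen i).card ≤ (Finset.range (bitlen i + 1)).card := by
        refine Finset.card_le_card fun b hb => ?_
        obtain ⟨j, hj, rfl⟩ := Finset.mem_image.mp hb
        have := hmono (Nat.lt_succ_iff.mp (Finset.mem_range.mp hj))
        simp; omega
    _ = bitlen i + 1 := Finset.card_range _

theorem card_SW_le_of_isBigO (hmono : Monotone bitlen)
    (h : (fun x : ℕ => (bitlen x : ℝ)) =O[Filter.atTop] (fun x : ℕ => Real.log (x : ℝ))) :
    ∃ C : ℝ, 1 ≤ C ∧ ∀ i : ℕ, ((SW bitlen i).card : ℝ) ≤ C * max 1 (Real.log (i : ℝ)) := by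
  obtain ⟨c, hc, hb⟩ := h.exists_nonneg
  obtain ⟨N, hN⟩ := Filter.eventually_atTop.mp hb.bound
  have hN0 : (0 : ℝ) ≤ bitlen N := Nat.cast_nonneg _
  -- The factor `c` serves `i ≥ N`, the term `bitlen N` the smaller `i` by monotonicity, and `1` the
  -- codeword length zero.
  refine ⟨c + bitlen N + 1, by linarith, fun i => ?_⟩
  set M := max 1 (Real.log (i : ℝ))
  have hM : 1 ≤ M := le_max_left _ _
  have hcard : ((SW bitlen i).card : ℝ) ≤ bitlen i + 1 := by
    exact_mod_cast card_SW_le_bitlen hmono i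
  have hi : (bitlen i : ℝ) ≤ c * M + bitlen N := by
    rcases le_total N i with hNi | hiN
    · have h1 := hN i hNi
      rw [Real.norm_of_nonneg (Nat.cast_nonneg _),
        Real.norm_of_nonneg (Real.log_natCast_nonneg i)] at h1
      have h2 : c * Real.log i ≤ c * M := mul_le_mul_of_nonneg_left (le_max_right _ _) hc
      linarith
    · have h1 : (bitlen i : ℝ) ≤ bitlen N := by exact_mod_cast hmono hiN
      have h2 : 0 ≤ c * M := by positivity
      linarith
  have h3 : (bitlen N : ℝ) ≤ bitlen N * M := le_mul_of_one_le_right hN0 hM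
  calc ((SW bitlen i).card : ℝ) ≤ c * M + bitlen N * M + M := by linarith
    _ = (c + bitlen N + 1) * M := by ring

theorem sw_le (bitlen : ℕ → ℕ) (n m : ℕ) : sw bitlen n m ≤ n := by
  unfold sw
  rcases Nat.lt_or_ge (m - 1) (swList bitlen n).length with h | h
  · rw [List.getD_eq_getElem _ _ h]
    exact le_of_mem_SW ((Finset.mem_sort (· ≤ ·)).mp (List.getElem_mem h))
  · rw [List.getD_eq_default _ _ h]
    exact Nat.zero_le _

theorem one_le_sw {n m : ℕ} (hm : 2 ≤ m) (hm' : m ≤ (SW bitlen n).card) : 1 ≤ sw bitlen n m := by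
  rw [← swList_length] at hm'
  unfold sw
  rw [List.getD_eq_getElem _ _ (by omega)]
  have h := (Finset.sortedLT_sort (SW bitlen n)).getElem_lt_getElem_of_lt (i := 0) (j := m - 1)
    (hi := show 0 < (swList bitlen n).length by omega)
    (hj := show m - 1 < (swList bitlen n).length by omega) (by omega)
  exact Nat.one_le_of_lt h

theorem card_SW_le_of_exponentialGrowth (h : ExponentialGrowth bitlen) :
    ∃ C : ℝ, 1 ≤ C ∧ ∀ i : ℕ, ((SW bitlen i).card : ℝ) ≤ C * max 1 (Real.log (i : ℝ)) := by
  obtain ⟨k, hk, k', hgrow⟩ := h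
  set m₀ := max 2 k' with hm₀
  have hlogk : 0 < Real.log k := Real.log_pos hk
  refine ⟨m₀ + 1 + 1 / Real.log k, ?_, fun i => ?_⟩
  · have : (0 : ℝ) ≤ m₀ := Nat.cast_nonneg _
    have : 0 < 1 / Real.log k := by positivity
    linarith
  set M := max 1 (Real.log (i : ℝ))
  have hM : 1 ≤ M := le_max_left _ _
  -- The induction starts at `m₀ ≥ 2` because the smallest layer may have size `0`. The last layer
  -- is left out, since it is cut off at the text length.
  have hpow : ∀ d, m₀ + d < (SW bitlen i).card → k ^ d ≤ sw bitlen i (m₀ + d) := by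
    intro d
    induction d with
    | zero =>
      intro hd
      simpa using one_le_sw (bitlen := bitlen) (le_max_left 2 k') hd.le
    | succ d ih =>
      intro hd
      have h1 := ih (by omega)
      have h2 := hgrow i (m₀ + (d + 1)) (by omega) (by omega) hd
      rw [show m₀ + (d + 1) - 1 = m₀ + d by omega] at h2
      rw [pow_succ, mul_comm]
      exact (mul_le_mul_of_nonneg_left h1 (by linarith)).trans h2
  have hcard : ((SW bitlen i).card : ℝ) ≤ (m₀ + 1) + M / Real.log k := by
    rcases Nat.lt_or_ge m₀ (SW bitlen i).card with hlt | hge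
    -- Here `m₀ + d` is the index of the last layer but one, whose size is at most `i`.
    · obtain ⟨d, hd⟩ := Nat.exists_eq_add_of_lt hlt
      have h1 : k ^ d ≤ (i : ℝ) :=
        (hpow d (by omega)).trans (by exact_mod_cast sw_le bitlen i _)
      have h2 : (d : ℝ) * Real.log k ≤ M := by
        rw [← Real.log_pow]
        exact (Real.log_le_log (by positivity) h1).trans (le_max_right _ _)
      have h3 : (d : ℝ) ≤ M / Real.log k := (le_div_iff₀ hlogk).mpr h2
      rw [hd]
      push_cast
      linarith
    · have h1 : ((SW bitlen i).card : ℝ) ≤ m₀ := by exact_mod_cast hge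
      have h2 : 0 ≤ M / Real.log k := by positivity
      linarith
  have h4 : (m₀ + 1 : ℝ) ≤ (m₀ + 1) * M := le_mul_of_one_le_right (by positivity) hM
  calc ((SW bitlen i).card : ℝ) ≤ (m₀ + 1) * M + M / Real.log k := by linarith
    _ = (m₀ + 1 + 1 / Real.log k) * M := by ring

theorem IsClassicCode.card_SW_le (h : IsClassicCode bitlen) :
    ∃ C : ℝ, 1 ≤ C ∧ ∀ i : ℕ, ((SW bitlen i).card : ℝ) ≤ C * max 1 (Real.log (i : ℝ)) :=
  h.2.elim card_SW_le_of_exponentialGrowth (card_SW_le_of_isBigO h.1)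

/-- Used with `x = log i`: the logarithm turns the factor `C` into a summand, which is absorbed
because the maximum is at least `1`. -/
theorem natLog_two_add_one_le {C x : ℝ} (hC : 1 ≤ C) {s : ℕ} (hs : (s : ℝ) ≤ C * max 1 x) :
    ((Nat.log 2 s + 1 : ℕ) : ℝ) ≤
      ((Real.log C + 1) / Real.log 2 + 1) * max 1 (Real.log x) := by
  set L := max 1 (Real.log x)
  have hL : 1 ≤ L := le_max_left _ _
  have hlog2 : 0 < Real.log 2 := Real.log_pos (by norm_num)
  have hlogC : 0 ≤ Real.log C := Real.log_nonneg hC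
  have hmax : Real.log (max 1 x) ≤ L := by
    rcases le_total 1 x with h | h
    · rw [max_eq_right h]; exact le_max_right _ _
    · rw [max_eq_left h, Real.log_one]; linarith
  have hlogs : Real.log s ≤ (Real.log C + 1) * L := by
    rcases Nat.eq_zero_or_pos s with rfl | hpos
    · simp only [Nat.cast_zero, Real.log_zero]; positivity
    · calc Real.log s ≤ Real.log (C * max 1 x) := Real.log_le_log (by exact_mod_cast hpos) hs
        _ = Real.log C + Real.log (max 1 x) := Real.log_mul (by linarith) (by positivity)
        _ ≤ Real.log C * L + L := add_le_add (le_mul_of_one_le_right hlogC hL) hmax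
        _ = (Real.log C + 1) * L := by ring
  have h1 : ((Nat.log 2 s : ℕ) : ℝ) ≤ Real.log s / Real.log 2 := by
    simpa [Real.logb] using Real.natLog_le_logb s 2
  have h2 : Real.log s / Real.log 2 ≤ (Real.log C + 1) * L / Real.log 2 :=
    div_le_div_of_nonneg_right hlogs hlog2.le
  push_cast
  calc ((Nat.log 2 s : ℕ) : ℝ) + 1 ≤ (Real.log C + 1) * L / Real.log 2 + L := by linarith
    _ = ((Real.log C + 1) / Real.log 2 + 1) * L := by ring

end CardBound

/-! ### Construction of a memory image -/

section Existence

open scoped Classical in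
/-- The content of cell `r` of the record of the node `v`, if the records are at the addresses
`addr`. -/
noncomputable def cell {σ : ℕ} (T : List (Fin σ)) (α : ℕ) (addr : List (Fin σ) → ℕ)
    (v : List (Fin σ)) (r : ℕ) : ℕ :=
  if r = 0 then v.length
  else if r = 1 then
    if h : ∃ x u y, (∃ a, IsEdge (window T α) u a v) ∧ windowStart T α ≤ y ∧ v <+: T.drop y ∧
      x = y + u.length then h.choose else 0
  else if h : ∃ (v' : List (Fin σ)) (a : Fin σ), r = 2 + a ∧ IsEdge (window T α) v a v' then
    addr h.choose else 0

/-- Memory holding the records given by `cell` at `addr` holds the suffix tree. -/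
theorem storesSuffixTree_of_cell {σ : ℕ} {mem : ℕ → ℕ} {T : List (Fin σ)} {α root : ℕ}
    {addr : List (Fin σ) → ℕ} (hroot : addr [] = root) (hinj : Function.Injective addr)
    (hne : ∀ v, addr v ≠ 0)
    (hmem : ∀ v r, r < σ + 2 → mem (addr v + r) = cell T α addr v r) :
    StoresSuffixTree mem T α root := by
  refine ⟨addr, hroot, hinj.injOn, fun v _ => ⟨hne v, ?_⟩, fun u a v he => ⟨?_, ?_⟩,
    fun u a _ hno => ?_⟩
  · simpa [cell] using hmem v 0 (by omega)
  · have hex : ∃ (v' : List (Fin σ)) (b : Fin σ), 2 + (a : ℕ) = 2 + b ∧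
        IsEdge (window T α) u b v' := ⟨v, a, rfl, he⟩
    rw [add_assoc, hmem u _ (by omega), cell, if_neg (by omega), if_neg (by omega), dif_pos hex]
    obtain ⟨b, hb, he'⟩ := hex.choose_spec
    obtain rfl : a = b := Fin.ext (by omega)
    rw [he.child_unique he']
  · have hex : ∃ x u y, (∃ a, IsEdge (window T α) u a v) ∧ windowStart T α ≤ y ∧
        v <+: T.drop y ∧ x = y + u.length := by
      obtain ⟨y, hy, hvy⟩ := inLayer_iff.mp he.2.1.isInfix
      exact ⟨_, u, y, ⟨a, he⟩, hy, hvy, rfl⟩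
    -- The choice in `cell` may name another parent `u'`; uniqueness of the parent identifies it
    -- with `u`.
    obtain ⟨u', y, ⟨a', he'⟩, hy, hvy, hx⟩ := hex.choose_spec
    refine ⟨y, hy, hvy, ?_⟩
    rw [hmem v 1 (by omega), cell, if_neg one_ne_zero, if_pos rfl, dif_pos hex, hx,
      he.parent_unique he']
  · rw [add_assoc, hmem u _ (by omega), cell, if_neg (by omega), if_neg (by omega), dif_neg]
    rintro ⟨v, b, hb, he⟩
    obtain rfl : a = b := Fin.ext (by omega)
    exact hno ⟨v, he⟩

/-- The records of all layers, in blocks of `σ + 2` cells from address `base` on. -/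
def blockAddr (σ base m : ℕ) (v : List (Fin σ)) : ℕ :=
  base + (σ + 2) * Encodable.encode (m, v)

/-- Text, pattern, array of the roots and records of the nodes, in this order. -/
noncomputable def layout {σ : ℕ} (T p : List (Fin σ)) (L : List ℕ) (x : ℕ) : ℕ :=
  let rootsEnd := T.length + p.length + L.length + 1
  if h : x < T.length then T[x]
  else if h : x - T.length < p.length then p[x - T.length]
  else if x < rootsEnd then blockAddr σ rootsEnd (x - T.length - p.length) []
  else match (Encodable.decode ((x - rootsEnd) / (σ + 2)) : Option (ℕ × List (Fin σ))) with
    | none => 0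
    | some (m, v) => cell T (L.getD m 0) (blockAddr σ rootsEnd m) v ((x - rootsEnd) % (σ + 2))

/-- As `r` is below the block size, quotient and remainder recover the code of `(m, v)` and the cell
number. -/
theorem layout_blockAddr {σ : ℕ} (T p : List (Fin σ)) (L : List ℕ) (m : ℕ) (v : List (Fin σ))
    {r : ℕ} (hr : r < σ + 2) :
    layout T p L (blockAddr σ (T.length + p.length + L.length + 1) m v + r) =
      cell T (L.getD m 0) (blockAddr σ (T.length + p.length + L.length + 1) m) v r := by
  have h1 : blockAddr σ (T.length + p.length + L.length + 1) m v + r -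
      (T.length + p.length + L.length + 1) = r + (σ + 2) * Encodable.encode (m, v) := by
    unfold blockAddr; omega
  have h2 : T.length + p.length + L.length + 1 ≤
      blockAddr σ (T.length + p.length + L.length + 1) m v := by
    unfold blockAddr; omega
  unfold layout
  simp only
  rw [dif_neg (by omega), dif_neg (by omega), if_neg (by omega), h1,
    Nat.add_mul_div_left _ _ (by omega), Nat.div_eq_of_lt hr, Nat.add_mul_mod_self_left,
    Nat.mod_eq_of_lt hr, zero_add, Encodable.encodek]

theorem exists_storesMLST_storesPattern {σ : ℕ} (bitlen : ℕ → ℕ) (T p : List (Fin σ)) :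
    ∃ s : State, StoresMLST bitlen T s ∧ StoresPattern p s := by
  set L := swList bitlen T.length with hL
  let s : State :=
    { reg := fun r => if r = 0 then 0 else if r = 1 then T.length + p.length else
        if r = 2 then L.length else if r = 3 then T.length else p.length
      mem := layout T p L }
  refine ⟨s, ⟨fun j h => ?_, rfl, fun m h => ?_⟩, fun j h => ?_, rfl⟩
  · simp [s, layout, h]
  · rw [← hL] at h
    refine storesSuffixTree_of_cell
      (addr := blockAddr σ (T.length + p.length + L.length + 1) m) ?_ ?_ ?_ ?_
    · have h1 : T.length + p.length + m - T.length - p.length = m := by omega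
      change _ = layout T p L (T.length + p.length + m)
      simp only [layout]
      rw [dif_neg (by omega), dif_neg (by omega),
        if_pos (by omega), h1]
    · intro u v huv
      unfold blockAddr at huv
      have h1 := Nat.eq_of_mul_eq_mul_left (by omega) (Nat.add_left_cancel huv)
      simpa using Encodable.encode_injective h1
    -- Addresses are non-zero thanks to the `+ 1` in the base address.
    · intro v
      unfold blockAddr; omega
    · intro v r hr
      rw [← List.getD_eq_getElem L 0 h]
      exact layout_blockAddr T p L m v hr
  · simp [s, layout, h]

end Existence

end MLST

theorem mainTheorem1 :
    (∀ (bitlen : ℕ → ℕ) (σ : ℕ) (T p : List (Fin σ)) (i : ℕ), i ≤ T.length →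
      ∃ s : MLST.State, MLST.StoresMLST bitlen (T.take i) s ∧ MLST.StoresPattern p s) ∧
    ∃ query : MLST.Program, ∀ bitlen : ℕ → ℕ, MLST.IsClassicCode bitlen → ∃ C : ℝ,
      (∀ i : ℕ, ((MLST.SW bitlen i).card : ℝ) ≤ C * max 1 (Real.log (i : ℝ))) ∧
      ∀ (σ : ℕ) (T p : List (Fin σ)) (i : ℕ) (s : MLST.State), i ≤ T.length → p ≠ [] →
        MLST.StoresMLST bitlen (T.take i) s → MLST.StoresPattern p s →
        ∃ (s' : MLST.State) (t : ℕ),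
          MLST.Run query s s' t ∧
          (t : ℝ) ≤ C * ((p.length : ℝ) * max 1 (Real.log (Real.log (i : ℝ)))) ∧
          s'.mem = s.mem ∧
          MLST.IsREP bitlen (T.take i) p (s'.reg 0) ∧
          (∀ y, s'.reg 0 = y + 1 → ∀ α ∈ MLST.SW bitlen i,
            MLST.InLayer (T.take i) α p → MLST.windowStart (T.take i) α ≤ y) := by
  refine ⟨fun bitlen σ T p i _ => MLST.exists_storesMLST_storesPattern bitlen (T.take i) p,
    MLST.queryProg, fun bitlen hcode => ?_⟩
  obtain ⟨C, hC, hcard⟩ := hcode.card_SW_le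
  set D := (Real.log C + 1) / Real.log 2 + 1 with hD
  have hD0 : 0 ≤ D := by
    have := Real.log_nonneg hC
    have := Real.log_pos (one_lt_two (α := ℝ))
    positivity
  refine ⟨C + 34 * D, fun i => (hcard i).trans ?_, fun σ T p i s hi hp hst hpat => ?_⟩
  · exact mul_le_mul_of_nonneg_right (by linarith) (zero_le_one.trans (le_max_left _ _))
  have hlen : (T.take i).length = i := by simpa using hi
  obtain ⟨s', t, hrun, ht, hmem, hrep, hlayer⟩ := MLST.run_queryProg hcode.1 hp hst hpat
  rw [hlen] at ht hlayer
  refine ⟨s', t, hrun, ?_, hmem, hrep, hlayer⟩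
  have hp1 : 1 ≤ p.length := List.length_pos_iff.mpr hp
  -- The constant is `15 + 12 + 7`, using that both factors are at least `1`.
  have ht' : t ≤ 34 * (p.length * (Nat.log 2 (MLST.SW bitlen i).card + 1)) := by
    generalize Nat.log 2 (MLST.SW bitlen i).card = k at ht
    nlinarith [Nat.zero_le k]
  have hlog := MLST.natLog_two_add_one_le hC (hcard i)
  set L := max 1 (Real.log (Real.log (i : ℝ)))
  have hpL : 0 ≤ (p.length : ℝ) * L :=
    mul_nonneg (Nat.cast_nonneg _) (zero_le_one.trans (le_max_left _ _))
  calc (t : ℝ) ≤ 34 * ((p.length : ℝ) * ((Nat.log 2 (MLST.SW bitlen i).card + 1 : ℕ) : ℝ)) := by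
        exact_mod_cast ht'
    _ ≤ 34 * ((p.length : ℝ) * (D * L)) := by gcongr
    _ = 34 * D * (p.length * L) := by ring
    _ ≤ (C + 34 * D) * (p.length * L) := mul_le_mul_of_nonneg_right (by linarith) hpL
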